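/- Let $\mathbb{T}=\mathbb{R}/\mathbb{Z}$ be the circle with Lebesgue measure $m$ normalized so that $m(\mathbb{T})=1$; write $|A|=m(A)$, and say that $A$ is almost contained in $B$ if $|A\setminus B|=0$. An interval of $\mathbb{T}$ is an arc with or without its endpoints ($\mathbb{T}$ itself included). Let $h$ be a measure function, i.e. a function on $[0,1]$ that is continuous and increasing with $h(0)=0$, such that $t\mapsto h(t)/t$ is decreasing on $(0,1]$ and $\lim_{t\to0^+}h(t)/t=+\infty$. A closed set $A\subseteq\mathbb{T}$ is called $h$-Carleson if the disjoint open arcs $\ell_n$ which constitute $\mathbb{T}\setminus A$ satisfy $\sum_n h(|\ell_n|)<\infty$. Let $E\subseteq\mathbb{T}$ be measurable, and let $E=(\mathrm{res}_h(E)\cup\mathrm{core}_h(E))\setminus N$ be its core-residual decomposition, i.e. $|N|=0$, $\mathrm{res}_h(E)$ and $\mathrm{core}_h(E)$ are disjoint and measurable, every $h$-Carleson set almost contained in $E$ is almost contained in $\mathrm{core}_h(E)$, and $\mathrm{core}_h(E)$ is, up to a set of measure zero, a countable union of $h$-Carleson sets almost contained in $E$. (Such a decomposition exists and is unique up to sets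 of measure zero; the statement holds for every choice of representatives.) Then there exists a sequence $\{f_n\}_n$ of real-valued bounded measurable functions on $\mathbb{T}$ such that (i) $\int_\Delta f_n\,dm\le 2h(|\Delta|)$ for every $n$ and every interval $\Delta$ of $\mathbb{T}$; (ii) $\int_{\mathbb{T}} f_n\,dm=0$ for every $n$; (iii) for every $n$, $f_n(x)=0$ for almost every $x\in\mathrm{core}_h(E)$; (iv) for every $n$, $f_n(x)\le 0$ for almost every $x\in\mathrm{res}_h(E)$; (v) there is a set $Z$ of measure zero such that $f_n(x)\to-\infty$ as $n\to\infty$, uniformly for $x\in\mathrm{res}_h(E)\setminus Z$. -/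

import Mathlib

open Set Filter Topology MeasureTheory

/-- A measure function: continuous and increasing with `h 0 = 0`, and `h t / t` decreasing with
`h t / t → ∞` as `t → 0+`. Only the values on `[0, 1]` matter, as the total length of the circle
is `1`. -/
structure IsMeasureFunction (h : ℝ → ℝ) : Prop where
  continuousOn : ContinuousOn h (Icc 0 1)
  monotoneOn : MonotoneOn h (Icc 0 1)
  map_zero : h 0 = 0
  antitoneOn_div : AntitoneOn (fun t => h t / t) (Ioc 0 1)
  tendsto_div : Tendsto (fun t => h t / t) (𝓝[>] 0) atTop

/-- An interval (arc) of the circle `𝕋 = ℝ / ℤ`: the image of a bounded real interval of length at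
most `1`, with or without each of its endpoints. The whole circle is an arc of length `1`. -/
def IsArc (Δ : Set UnitAddCircle) : Prop :=
  ∃ (a b : ℝ) (J : Set ℝ), a ≤ b ∧ b ≤ a + 1 ∧ Ioo a b ⊆ J ∧ J ⊆ Icc a b ∧
    Δ = (fun t : ℝ => (t : UnitAddCircle)) '' J

/-- A closed set `A` is `h`-Carleson if the disjoint open arcs `ℓ` which constitute its complement
satisfy `∑ h(|ℓ|) < ∞`. -/
def IsHCarleson (h : ℝ → ℝ) (A : Set UnitAddCircle) : Prop :=
  IsClosed A ∧ ∃ L : Set (Set UnitAddCircle),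
    (∀ ℓ ∈ L, IsOpen ℓ ∧ IsArc ℓ) ∧ L.PairwiseDisjoint id ∧ ⋃₀ L = Aᶜ ∧
    Summable (fun ℓ : L => h (volume.real (ℓ : Set UnitAddCircle)))

/-- `A` is almost contained in `B`. -/
def AlmostContained (A B : Set UnitAddCircle) : Prop := volume (A \ B) = 0

/-- `core` and `res` form the core-residual decomposition of `E` with respect to `h` (the two sets
are determined by `E` and `h` up to null sets, and any representatives are allowed). -/
structure IsCoreResidual (h : ℝ → ℝ) (E core res : Set UnitAddCircle) : Prop where
  measurable_core : NullMeasurableSet core volume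
  measurable_res : NullMeasurableSet res volume
  disjoint : Disjoint res core
  decomp : ∃ N : Set UnitAddCircle, volume N = 0 ∧ E = (res ∪ core) \ N
  carleson_subset : ∀ A, IsHCarleson h A → AlmostContained A E → AlmostContained A core
  core_eq : ∃ G : ℕ → Set UnitAddCircle,
    (∀ n, IsHCarleson h (G n) ∧ AlmostContained (G n) E) ∧ core =ᵐ[volume] ⋃ n, G n

theorem isHCarleson_empty (h : ℝ → ℝ) : IsHCarleson h ∅ := by
  refine ⟨isClosed_empty, {univ}, ?_, pairwiseDisjoint_singleton _ _, by simp, ?_⟩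
  · rintro ℓ rfl
    refine ⟨isOpen_univ, 0, 1, Icc 0 1, by norm_num, by norm_num, Ioo_subset_Icc_self, le_rfl, ?_⟩
    have := AddCircle.coe_image_Icc_eq (1 : ℝ) 0
    simpa using this.symm
  · exact (hasSum_fintype _).summable

/-- Every measurable set has a core-residual decomposition. -/
theorem exists_isCoreResidual (h : ℝ → ℝ) {E : Set UnitAddCircle}
    (hE : NullMeasurableSet E volume) : ∃ core res, IsCoreResidual h E core res := by
  let S : Set (ℕ → Set UnitAddCircle) := {G | ∀ n, IsHCarleson h (G n) ∧ AlmostContained (G n) E}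
  let m : (ℕ → Set UnitAddCircle) → ENNReal := fun G => volume (⋃ n, G n)
  have hS : S.Nonempty := ⟨fun _ => ∅, fun _ => ⟨isHCarleson_empty h, by simp [AlmostContained]⟩⟩
  obtain ⟨u, -, hu, huS⟩ := exists_seq_tendsto_sSup (hS.image m) (OrderTop.bddAbove _)
  choose V hVS hVu using huS
  let G : ℕ → Set UnitAddCircle := fun k => V k.unpair.1 k.unpair.2
  have hG : ∀ n, IsHCarleson h (G n) ∧ AlmostContained (G n) E := fun n => hVS _ _
  have hsub : ∀ k, (⋃ n, V k n) ⊆ ⋃ n, G n := by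
    intro k
    refine iUnion_subset fun n => ?_
    have : G (Nat.pair k n) = V k n := by simp [G]
    rw [← this]
    exact subset_iUnion G _
  have hle : sSup (m '' S) ≤ volume (⋃ n, G n) :=
    le_of_tendsto' hu fun k => (hVu k) ▸ measure_mono (hsub k)
  have hmeas : MeasurableSet (⋃ n, G n) := MeasurableSet.iUnion fun n => (hG n).1.1.measurableSet
  refine ⟨⋃ n, G n, E \ ⋃ n, G n, hmeas.nullMeasurableSet, hE.diff hmeas.nullMeasurableSet,
    disjoint_sdiff_left, ⟨(⋃ n, G n) \ E, ?_, ?_⟩, ?_, G, hG, EventuallyEq.rfl⟩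
  · rw [iUnion_sdiff]
    exact measure_iUnion_null fun n => (hG n).2
  · ext x
    simp only [Set.mem_sdiff, mem_union]
    tauto
  · intro A hA hAE
    let G' : ℕ → Set UnitAddCircle := fun n => Nat.casesOn n A G
    have hG'S : G' ∈ S := by
      intro n
      cases n with
      | zero => exact ⟨hA, hAE⟩
      | succ n => exact hG n
    have hU : (⋃ n, G' n) = (A \ ⋃ n, G n) ∪ ⋃ n, G n := by
      rw [sdiff_union_self]
      ext x
      simp only [mem_iUnion, mem_union]
      constructor
      · rintro ⟨n, hn⟩
        cases n with
        | zero => exact Or.inl hn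
        | succ n => exact Or.inr ⟨n, hn⟩
      · rintro (hx | ⟨n, hn⟩)
        · exact ⟨0, hx⟩
        · exact ⟨n + 1, hn⟩
    have h1 : volume (⋃ n, G' n) ≤ volume (⋃ n, G n) :=
      (le_sSup (mem_image_of_mem m hG'S)).trans hle
    rw [hU, measure_union disjoint_sdiff_left hmeas] at h1
    have hfin : volume (⋃ n, G n) ≠ ⊤ := measure_ne_top _ _
    have h2 : volume (A \ ⋃ n, G n) + volume (⋃ n, G n) ≤ 0 + volume (⋃ n, G n) := by
      simpa using h1
    exact le_antisymm ((ENNReal.add_le_add_iff_right hfin).1 h2) zero_le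

/-! Put R = res, P = the complement of E, and fix c = n. It suffices to find f equal to -c on R,
zero on core, nonnegative and bounded on P, with mean zero and integrals controlled by h.

Cut the circle at 0 and let F(x) be the least cost of travelling from 0 to x, where a step costs
either the integral of u = M·1_P - c·1_R or h of its length. Appending a jump gives F(y) - F(x) ≤
h(y - x), appending a gap gives F' ≤ u, and cutting a path short gives F' ≥ -c·1_R. So F' is -c on
R, zero off R ∪ P, and between 0 and M on P (`exists_density_le`). If every path to 1 has
nonnegative cost, then ∫F' ≥ 0, and shrinking the part on P makes the mean zero
(`exists_bounded_density`).

It remains to see that a large M makes all costs nonnegative (`exists_pathCost_nonneg`). A path with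
jump set U of lengths l_k costs Σ h(l_k) + M|P \ U| - c|R \ U|. If negative costs occur for every M,
then Σ h(l_k) ≤ c and |P \ U| → 0. Since h(t)/t → ∞, the tails of Σ l_k are uniformly small, so a
subsequence of the jump families converges without loss of measure. The limiting U covers almost all
of P, and its complement is h-Carleson and almost contained in E, hence in core; so U covers almost
all of R too. Then Σ h(l_k) ≤ c|R \ U| → 0, the limiting jumps are degenerate, and R is null, which
contradicts negative cost. -/

namespace IsMeasureFunction

variable {h : ℝ → ℝ}

theorem nonneg (hh : IsMeasureFunction h) {t : ℝ} (h0 : 0 ≤ t) (h1 : t ≤ 1) : 0 ≤ h t := by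
  rw [← hh.map_zero]
  exact hh.monotoneOn ⟨le_rfl, zero_le_one⟩ ⟨h0, h1⟩ h0

theorem mono (hh : IsMeasureFunction h) {s t : ℝ} (h0 : 0 ≤ s) (hst : s ≤ t) (h1 : t ≤ 1) :
    h s ≤ h t :=
  hh.monotoneOn ⟨h0, hst.trans h1⟩ ⟨h0.trans hst, h1⟩ hst

end IsMeasureFunction

/-! ### Paths and their least cost -/

/-- `PathCost h u x v`: the point `x` can be reached from `0` at total cost `v` by moving to the
right inside `[0, 1]`, where a step from `x` to `y` costs either `∫ t in x..y, u t` or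
`h (y - x)`. -/
inductive PathCost (h u : ℝ → ℝ) : ℝ → ℝ → Prop
  | zero : PathCost h u 0 0
  | gap (x v y : ℝ) : PathCost h u x v → x ≤ y → y ≤ 1 → PathCost h u y (v + ∫ t in x..y, u t)
  | jump (x v y : ℝ) : PathCost h u x v → x ≤ y → y ≤ 1 → PathCost h u y (v + h (y - x))

namespace PathCost

variable {h u w : ℝ → ℝ}

theorem nonneg {x v : ℝ} (p : PathCost h u x v) : 0 ≤ x := by
  induction p with
  | zero => exact le_rfl
  | gap x v y _ hxy _ ih => exact ih.trans hxy
  | jump x v y _ hxy _ ih => exact ih.trans hxy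

theorem neg_integral_le (huw : ∀ t, -w t ≤ u t) (hu : ∀ a b, IntervalIntegrable u volume a b)
    (hw : ∀ a b, IntervalIntegrable w volume a b) {x y : ℝ} (hxy : x ≤ y) :
    -∫ t in x..y, w t ≤ ∫ t in x..y, u t := by
  rw [← intervalIntegral.integral_neg]
  exact intervalIntegral.integral_mono_on hxy (hw x y).neg (hu x y) fun t _ => huw t

/-- A gap costs at least -∫ w and a jump at least 0. This makes the infimum in `leastCost` a genuine
one. -/
theorem lower_bound (hh : IsMeasureFunction h) (hw0 : ∀ t, 0 ≤ w t) (huw : ∀ t, -w t ≤ u t)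
    (hu : ∀ a b, IntervalIntegrable u volume a b) (hw : ∀ a b, IntervalIntegrable w volume a b)
    {x v : ℝ} (p : PathCost h u x v) : -∫ t in (0 : ℝ)..x, w t ≤ v := by
  induction p with
  | zero => simp
  | gap x v y p hxy _ ih =>
    rw [← intervalIntegral.integral_add_adjacent_intervals (hw 0 x) (hw x y)]
    linarith [neg_integral_le huw hu hw hxy]
  | jump x v y p hxy hy ih =>
    rw [← intervalIntegral.integral_add_adjacent_intervals (hw 0 x) (hw x y)]
    have h1 := hh.nonneg (sub_nonneg.2 hxy) (by linarith [p.nonneg])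
    have h2 : 0 ≤ ∫ t in x..y, w t := intervalIntegral.integral_nonneg hxy fun t _ => hw0 t
    linarith

/-- A path to `y` can be cut off at any earlier point `x`. -/
theorem trim (hh : IsMeasureFunction h) (hw0 : ∀ t, 0 ≤ w t) (huw : ∀ t, -w t ≤ u t)
    (hu : ∀ a b, IntervalIntegrable u volume a b) (hw : ∀ a b, IntervalIntegrable w volume a b)
    {y v : ℝ} (p : PathCost h u y v) {x : ℝ} (hx : 0 ≤ x) (hxy : x ≤ y) :
    ∃ v', PathCost h u x v' ∧ v' ≤ v + ∫ t in x..y, w t := by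
  induction p generalizing x with
  | zero =>
    obtain rfl : x = 0 := le_antisymm hxy hx
    exact ⟨0, .zero, by simp⟩
  | gap z v y p hzy hy ih =>
    rcases le_total x z with hxz | hzx
    · obtain ⟨v', p', hv'⟩ := ih hx hxz
      refine ⟨v', p', ?_⟩
      rw [← intervalIntegral.integral_add_adjacent_intervals (hw x z) (hw z y)]
      linarith [neg_integral_le huw hu hw hzy]
    · refine ⟨_, p.gap _ _ x hzx (hxy.trans hy), ?_⟩
      rw [← intervalIntegral.integral_add_adjacent_intervals (hu z x) (hu x y)]
      linarith [neg_integral_le huw hu hw hxy]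
  | jump z v y p hzy hy ih =>
    rcases le_total x z with hxz | hzx
    · obtain ⟨v', p', hv'⟩ := ih hx hxz
      refine ⟨v', p', ?_⟩
      rw [← intervalIntegral.integral_add_adjacent_intervals (hw x z) (hw z y)]
      have h1 := hh.nonneg (sub_nonneg.2 hzy) (by linarith [p.nonneg])
      have h2 : 0 ≤ ∫ t in z..y, w t := intervalIntegral.integral_nonneg hzy fun t _ => hw0 t
      linarith
    · refine ⟨_, p.jump _ _ x hzx (hxy.trans hy), ?_⟩
      -- The last jump is shortened to end at `x`, which costs no more because `h` is increasing.
      have h1 : h (x - z) ≤ h (y - z) :=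
        hh.mono (sub_nonneg.2 hzx) (by linarith) (by linarith [p.nonneg])
      have h2 : 0 ≤ ∫ t in x..y, w t := intervalIntegral.integral_nonneg hxy fun t _ => hw0 t
      linarith

end PathCost

/-- The least cost of a path from `0` to `x`. -/
noncomputable def leastCost (h u : ℝ → ℝ) (x : ℝ) : ℝ := sInf {v | PathCost h u x v}

section leastCost

variable {h u w : ℝ → ℝ}

theorem leastCost_bddBelow (hh : IsMeasureFunction h) (hw0 : ∀ t, 0 ≤ w t)
    (huw : ∀ t, -w t ≤ u t) (hu : ∀ a b, IntervalIntegrable u volume a b)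
    (hw : ∀ a b, IntervalIntegrable w volume a b) (x : ℝ) : BddBelow {v | PathCost h u x v} :=
  ⟨_, fun _ p => p.lower_bound hh hw0 huw hu hw⟩

theorem leastCost_nonempty {x : ℝ} (hx : 0 ≤ x) (hx1 : x ≤ 1) : {v | PathCost h u x v}.Nonempty :=
  ⟨_, PathCost.zero.gap _ _ x hx hx1⟩

/-- Append one gap to a nearly optimal path to `x`; the next lemma appends one jump instead. -/
theorem leastCost_sub_le_integral (hh : IsMeasureFunction h) (hw0 : ∀ t, 0 ≤ w t)
    (huw : ∀ t, -w t ≤ u t) (hu : ∀ a b, IntervalIntegrable u volume a b)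
    (hw : ∀ a b, IntervalIntegrable w volume a b) {x y : ℝ} (hx : 0 ≤ x) (hxy : x ≤ y)
    (hy : y ≤ 1) : leastCost h u y - leastCost h u x ≤ ∫ t in x..y, u t := by
  have : leastCost h u y - ∫ t in x..y, u t ≤ leastCost h u x :=
    le_csInf (leastCost_nonempty hx (hxy.trans hy)) fun v p => by
      have : leastCost h u y ≤ _ :=
        csInf_le (leastCost_bddBelow hh hw0 huw hu hw y) (p.gap _ _ y hxy hy)
      linarith
  linarith

theorem leastCost_sub_le_apply (hh : IsMeasureFunction h) (hw0 : ∀ t, 0 ≤ w t)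
    (huw : ∀ t, -w t ≤ u t) (hu : ∀ a b, IntervalIntegrable u volume a b)
    (hw : ∀ a b, IntervalIntegrable w volume a b) {x y : ℝ} (hx : 0 ≤ x) (hxy : x ≤ y)
    (hy : y ≤ 1) : leastCost h u y - leastCost h u x ≤ h (y - x) := by
  have : leastCost h u y - h (y - x) ≤ leastCost h u x :=
    le_csInf (leastCost_nonempty hx (hxy.trans hy)) fun v p => by
      have : leastCost h u y ≤ _ :=
        csInf_le (leastCost_bddBelow hh hw0 huw hu hw y) (p.jump _ _ y hxy hy)
      linarith
  linarith

/-- Cut a nearly optimal path to `y` at `x`. This will give the lower bound for the derivative of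
the least cost. -/
theorem neg_integral_le_leastCost_sub (hh : IsMeasureFunction h) (hw0 : ∀ t, 0 ≤ w t)
    (huw : ∀ t, -w t ≤ u t) (hu : ∀ a b, IntervalIntegrable u volume a b)
    (hw : ∀ a b, IntervalIntegrable w volume a b) {x y : ℝ} (hx : 0 ≤ x) (hxy : x ≤ y)
    (hy : y ≤ 1) : -∫ t in x..y, w t ≤ leastCost h u y - leastCost h u x := by
  have : leastCost h u x - ∫ t in x..y, w t ≤ leastCost h u y :=
    le_csInf (leastCost_nonempty (hx.trans hxy) hy) fun v p => by
      obtain ⟨v', p', hv'⟩ := p.trim hh hw0 huw hu hw hx hxy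
      have : leastCost h u x ≤ _ := csInf_le (leastCost_bddBelow hh hw0 huw hu hw x) p'
      linarith
  linarith

end leastCost

/-! ### Differentiating the least cost -/

/-- If the increments of `F` are dominated by the integrals of `u`, then `F' ≤ u` at points of
differentiability. -/
theorem HasDerivAt.le_of_sub_le_integral {F u : ℝ → ℝ} {x F' : ℝ} (hF : HasDerivAt F F' x)
    (hu : HasDerivAt (fun y => ∫ t in x..y, u t) (u x) x)
    (hle : ∀ᶠ y in 𝓝[>] x, F y - F x ≤ ∫ t in x..y, u t) : F' ≤ u x := by
  have hsub : Ioi x ⊆ {x}ᶜ := fun y hy => ne_of_gt hy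
  have h1 := (hasDerivAt_iff_tendsto_slope.1 hF).mono_left
    (nhdsWithin_mono x hsub)
  have h2 := (hasDerivAt_iff_tendsto_slope.1 hu).mono_left
    (nhdsWithin_mono x hsub)
  refine le_of_tendsto_of_tendsto h1 h2 ?_
  filter_upwards [hle, self_mem_nhdsWithin] with y hy hxy
  have hxy : x < y := hxy
  simp only [slope_def_field, intervalIntegral.integral_same, sub_zero]
  exact div_le_div_of_nonneg_right hy (sub_nonneg.2 hxy.le)

/-- The density of the least cost. -/
theorem exists_density_le {h u w : ℝ → ℝ} {C : ℝ} (hh : IsMeasureFunction h)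
    (hw0 : ∀ t, 0 ≤ w t) (huw : ∀ t, -w t ≤ u t) (hu : Measurable u) (hw : Measurable w)
    (huC : ∀ t, |u t| ≤ C) (hwC : ∀ t, |w t| ≤ C) (hpos : ∀ v, PathCost h u 1 v → 0 ≤ v) :
    ∃ f : ℝ → ℝ, Measurable f ∧
      (∀ x y, 0 ≤ x → x ≤ y → y ≤ 1 → ∫ t in x..y, f t ≤ h (y - x)) ∧
      0 ≤ ∫ t in (0 : ℝ)..1, f t ∧ ∀ᵐ t, t ∈ Ioo (0 : ℝ) 1 → -w t ≤ f t ∧ f t ≤ u t := by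
  have hC : 0 ≤ C := (abs_nonneg _).trans (huC 0)
  have int : ∀ g : ℝ → ℝ, Measurable g → (∀ t, |g t| ≤ C) → LocallyIntegrable g volume := by
    intro g hg hgC
    refine (memLp_top_of_bound hg.aestronglyMeasurable C (ae_of_all _ hgC)).locallyIntegrable
      le_top
  have hui : ∀ a b, IntervalIntegrable u volume a b := fun a b =>
    ((int u hu huC).integrableOn_isCompact isCompact_uIcc).intervalIntegrable
  have hwi : ∀ a b, IntervalIntegrable w volume a b := fun a b =>
    ((int w hw hwC).integrableOn_isCompact isCompact_uIcc).intervalIntegrable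
  set F := leastCost h u
  have bd : ∀ g : ℝ → ℝ, (∀ t, |g t| ≤ C) → ∀ x y, x ≤ y → |∫ t in x..y, g t| ≤ C * (y - x) := by
    intro g hgC x y hxy
    have := intervalIntegral.norm_integral_le_of_norm_le_const (a := x) (b := y) (f := g) (C := C)
      fun t _ => hgC t
    rwa [Real.norm_eq_abs, abs_of_nonneg (sub_nonneg.2 hxy)] at this
  have hle : ∀ x y, 0 ≤ x → x ≤ y → y ≤ 1 → |F y - F x| ≤ C * (y - x) := by
    intro x y hx hxy hy
    have h1 := leastCost_sub_le_integral hh hw0 huw hui hwi hx hxy hy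
    have h2 := neg_integral_le_leastCost_sub hh hw0 huw hui hwi hx hxy hy
    have h3 := abs_le.1 (bd u huC x y hxy)
    have h4 := abs_le.1 (bd w hwC x y hxy)
    exact abs_le.2 ⟨by linarith, by linarith⟩
  -- Lipschitz, hence absolutely continuous: the increments of `F` are the integrals of `deriv F`.
  have hlip : LipschitzOnWith C.toNNReal F (Icc 0 1) := by
    refine LipschitzOnWith.of_dist_le_mul fun x hx y hy => ?_
    rw [Real.coe_toNNReal _ hC]
    rcases le_total x y with hxy | hxy
    · rw [dist_comm, dist_comm x, Real.dist_eq, Real.dist_eq, abs_of_nonneg (sub_nonneg.2 hxy)]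
      exact hle x y hx.1 hxy hy.2
    · rw [Real.dist_eq, Real.dist_eq, abs_of_nonneg (sub_nonneg.2 hxy)]
      exact hle y x hy.1 hxy hx.2
  have hac : ∀ x y, 0 ≤ x → x ≤ y → y ≤ 1 → ∫ t in x..y, deriv F t = F y - F x := by
    intro x y hx hxy hy
    refine AbsolutelyContinuousOnInterval.integral_deriv_eq_sub ?_
    refine LipschitzOnWith.absolutelyContinuousOnInterval (hlip.mono ?_)
    rw [uIcc_of_le hxy]
    exact Icc_subset_Icc hx hy
  refine ⟨deriv F, measurable_deriv F, ?_, ?_, ?_⟩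
  · intro x y hx hxy hy
    rw [hac x y hx hxy hy]
    exact leastCost_sub_le_apply hh hw0 huw hui hwi hx hxy hy
  · rw [hac 0 1 le_rfl zero_le_one le_rfl]
    have h1 : 0 ≤ F 1 := le_csInf (leastCost_nonempty zero_le_one le_rfl) hpos
    have h0 : F 0 ≤ 0 := csInf_le (leastCost_bddBelow hh hw0 huw hui hwi 0) .zero
    linarith
  · have hlip' : LipschitzOnWith C.toNNReal F (uIcc 0 1) := by rwa [uIcc_of_le zero_le_one]
    filter_upwards [hlip'.absolutelyContinuousOnInterval.ae_differentiableAt,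
      LocallyIntegrable.ae_hasDerivAt_integral (int u hu huC), LocallyIntegrable.ae_hasDerivAt_integral (int w hw hwC)]
      with x hx hux hwx hx1
    have hd := (hx (by rw [uIcc_of_le zero_le_one]; exact Ioo_subset_Icc_self hx1)).hasDerivAt
    have hev : ∀ᶠ y in 𝓝[>] x, x < y ∧ y < 1 := Ioo_mem_nhdsGT hx1.2
    constructor
    -- Applied to `-F`, whose increments are at most those of the integral of `w`.
    · have := HasDerivAt.le_of_sub_le_integral hd.neg (hwx x) (by
        filter_upwards [hev] with y hy
        have := neg_integral_le_leastCost_sub hh hw0 huw hui hwi hx1.1.le hy.1.le hy.2.le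
        simp only [Pi.neg_apply]
        linarith)
      linarith
    · refine HasDerivAt.le_of_sub_le_integral hd (hux x) ?_
      filter_upwards [hev] with y hy
      exact leastCost_sub_le_integral hh hw0 huw hui hwi hx1.1.le hy.1.le hy.2.le

/-! ### The jumps of a path as a family of intervals -/

namespace PathCost

variable {h u : ℝ → ℝ}

/-- The jumps of a path are finitely many non-overlapping intervals. -/
theorem exists_fin (hu : ∀ a b, IntervalIntegrable u volume a b) {x v : ℝ}
    (p : PathCost h u x v) : ∃ (n : ℕ) (a b : Fin n → ℝ),
      (∀ i, 0 ≤ a i ∧ a i ≤ b i ∧ b i ≤ x) ∧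
      (Pairwise fun i j => Disjoint (Ioo (a i) (b i)) (Ioo (a j) (b j))) ∧
      v = ∑ i, (h (b i - a i) - ∫ t in a i..b i, u t) + ∫ t in (0 : ℝ)..x, u t := by
  induction p with
  | zero => exact ⟨0, Fin.elim0, Fin.elim0, fun i => i.elim0, fun i => i.elim0, by simp⟩
  | gap x v y p hxy hy ih =>
    obtain ⟨n, a, b, hab, hd, rfl⟩ := ih
    refine ⟨n, a, b, fun i => ⟨(hab i).1, (hab i).2.1, (hab i).2.2.trans hxy⟩, hd, ?_⟩
    rw [← intervalIntegral.integral_add_adjacent_intervals (hu 0 x) (hu x y)]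
    ring
  | jump x v y p hxy hy ih =>
    obtain ⟨n, a, b, hab, hd, rfl⟩ := ih
    have hlast : ∀ i, Disjoint (Ioo (a i) (b i)) (Ioo x y) := fun i =>
      Set.disjoint_left.2 fun t ht ht' => by linarith [ht.2, ht'.1, (hab i).2.2]
    refine ⟨n + 1, Fin.snoc (α := fun _ => ℝ) a x, Fin.snoc (α := fun _ => ℝ) b y, ?_, ?_, ?_⟩
    · intro i
      induction i using Fin.lastCases with
      | last => simpa using ⟨p.nonneg, hxy⟩
      | cast i => simpa using ⟨(hab i).1, (hab i).2.1, (hab i).2.2.trans hxy⟩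
    · intro i j hij
      induction i using Fin.lastCases with
      | last =>
        induction j using Fin.lastCases with
        | last => exact absurd rfl hij
        | cast j => simpa using (hlast j).symm
      | cast i =>
        induction j using Fin.lastCases with
        | last => simpa using hlast i
        | cast j => simpa using hd (fun h => hij (congrArg Fin.castSucc h))
    · rw [← intervalIntegral.integral_add_adjacent_intervals (hu 0 x) (hu x y),
        Fin.sum_univ_castSucc]
      simp only [Fin.snoc_castSucc, Fin.snoc_last]
      ring

/-- The jumps of a path, in the order of decreasing length. -/
theorem exists_antitone_seq (hu : ∀ a b, IntervalIntegrable u volume a b) {x v : ℝ}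
    (p : PathCost h u x v) : ∃ (n : ℕ) (a b : ℕ → ℝ),
      (∀ k, 0 ≤ a k ∧ a k ≤ b k ∧ b k ≤ x) ∧
      (Pairwise fun i j => Disjoint (Ioo (a i) (b i)) (Ioo (a j) (b j))) ∧
      Antitone (fun k => b k - a k) ∧ (∀ k, n ≤ k → a k = 0 ∧ b k = 0) ∧
      v = ∑ k ∈ Finset.range n, (h (b k - a k) - ∫ t in a k..b k, u t) +
        ∫ t in (0 : ℝ)..x, u t := by
  obtain ⟨n, a, b, hab, hd, rfl⟩ := p.exists_fin hu
  -- `Tuple.sort` is increasing, so sorting by minus the length puts the longest jumps first. Beyond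
  -- `n` the sequence is padded with the empty interval (0, 0).
  set σ := Tuple.sort fun i => a i - b i
  have hσ : ∀ i j, i ≤ j → b (σ j) - a (σ j) ≤ b (σ i) - a (σ i) := fun i j hij => by
    have := Tuple.monotone_sort (fun i => a i - b i) hij
    simp only [Function.comp_apply] at this
    change a (σ i) - b (σ i) ≤ a (σ j) - b (σ j) at this
    linarith
  refine ⟨n, fun k => if hk : k < n then a (σ ⟨k, hk⟩) else 0,
    fun k => if hk : k < n then b (σ ⟨k, hk⟩) else 0, ?_, ?_, ?_, ?_, ?_⟩
  · intro k
    by_cases hk : k < n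
    · simpa [hk] using hab _
    · simpa [hk] using p.nonneg
  · intro i j hij
    by_cases hi : i < n
    · by_cases hj : j < n
      · simp only [hi, hj, dif_pos]
        exact hd fun h => hij (by simpa using σ.injective h)
      · simp [hj]
    · simp [hi]
  · intro i j hij
    by_cases hj : j < n
    · simp only [hj, hij.trans_lt hj, dif_pos]
      exact hσ _ _ hij
    · by_cases hi : i < n
      · simpa [hi, hj] using (hab _).2.1
      · simp [hi, hj]
  · intro k hk
    simp [hk.not_gt]
  · rw [Finset.sum_range]
    simp only [Fin.is_lt, dif_pos, Fin.eta]
    rw [Equiv.sum_comp σ (fun i => h (b i - a i) - ∫ t in a i..b i, u t)]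

end PathCost

/-! ### Uniform tails of sequences of lengths -/

namespace IsMeasureFunction

variable {h : ℝ → ℝ}

/-- The limit of `h t / t` restated without division, so that `t = 0` is included. -/
theorem exists_le_mul (hh : IsMeasureFunction h) {ε : ℝ} (hε : 0 < ε) :
    ∃ δ, 0 < δ ∧ δ < 1 ∧ ∀ t, 0 ≤ t → t ≤ δ → t ≤ ε * h t := by
  obtain ⟨δ, hδ, H⟩ := mem_nhdsGT_iff_exists_Ioc_subset.1
    (hh.tendsto_div.eventually_ge_atTop ε⁻¹)
  refine ⟨min δ (1 / 2), lt_min hδ (by norm_num), (min_le_right _ _).trans_lt (by norm_num),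
    fun t ht0 ht => ?_⟩
  rcases ht0.eq_or_lt with rfl | ht0
  · simp [hh.map_zero]
  · have h1 : ε⁻¹ ≤ h t / t := H ⟨ht0, ht.trans (min_le_left _ _)⟩
    rw [le_div_iff₀ ht0] at h1
    have h2 := mul_le_mul_of_nonneg_left h1 hε.le
    rwa [← mul_assoc, mul_inv_cancel₀ hε.ne', one_mul] at h2

theorem pos (hh : IsMeasureFunction h) {t : ℝ} (h0 : 0 < t) (h1 : t ≤ 1) : 0 < h t := by
  obtain ⟨δ, hδ, hδ1, H⟩ := hh.exists_le_mul one_pos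
  have hs : 0 < min δ t := lt_min hδ h0
  have h2 := H _ hs.le (min_le_left _ _)
  have h3 := hh.mono hs.le (min_le_right δ t) h1
  linarith

/-- Uniform smallness of the tails of decreasing sequences of lengths with bounded `h`-sum. -/
theorem exists_tail_le (hh : IsMeasureFunction h) {c ε : ℝ} (hc : 0 ≤ c) (hε : 0 < ε) :
    ∃ K : ℕ, ∀ l : ℕ → ℝ, (∀ k, 0 ≤ l k ∧ l k ≤ 1) → Antitone l →
      (∀ n, ∑ k ∈ Finset.range n, h (l k) ≤ c) →
      Summable l ∧ ∑' k, l (k + K) ≤ ε := by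
  -- The denominator `c + 1` avoids division by zero when `c = 0`.
  obtain ⟨δ, hδ, hδ1, H⟩ := hh.exists_le_mul (ε := ε / (c + 1)) (by positivity)
  have hhδ := hh.pos hδ hδ1.le
  -- At most `c / h δ` of the lengths can exceed `δ`, so from index `K` on all are at most `δ`.
  obtain ⟨K, hK⟩ := exists_nat_gt (c / h δ)
  refine ⟨K, fun l hl hanti hsum => ?_⟩
  have hlt : ∀ k, K ≤ k → l k ≤ δ := by
    intro k hk
    by_contra! hlk
    have h1 : ∀ i ∈ Finset.range (k + 1), h δ ≤ h (l i) := fun i hi =>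
      hh.mono hδ.le (hlk.le.trans (hanti (Nat.lt_succ_iff.1 (Finset.mem_range.1 hi)))) (hl i).2
    have h2 := (Finset.card_nsmul_le_sum _ _ _ h1).trans (hsum (k + 1))
    rw [Finset.card_range, nsmul_eq_mul] at h2
    rw [div_lt_iff₀ hhδ] at hK
    have h3 : (K : ℝ) ≤ ((k + 1 : ℕ) : ℝ) := by exact_mod_cast hk.trans (Nat.le_succ k)
    have := mul_le_mul_of_nonneg_right h3 hhδ.le
    linarith
  have hpart : ∀ n, ∑ k ∈ Finset.range n, l (k + K) ≤ ε := by
    intro n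
    have h1 : ∑ k ∈ Finset.range n, l (k + K) ≤
        ε / (c + 1) * ∑ k ∈ Finset.range n, h (l (k + K)) := by
      rw [Finset.mul_sum]
      exact Finset.sum_le_sum fun k _ => H _ (hl _).1 (hlt _ (Nat.le_add_left _ _))
    have h2 : ∑ k ∈ Finset.range n, h (l (k + K)) ≤ c := by
      have h3 := hsum (K + n)
      rw [Finset.sum_range_add] at h3
      have h4 : 0 ≤ ∑ k ∈ Finset.range K, h (l k) :=
        Finset.sum_nonneg fun k _ => hh.nonneg (hl k).1 (hl k).2
      simp only [add_comm _ K]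
      linarith
    have h5 : ε / (c + 1) * c ≤ ε := by
      rw [div_mul_eq_mul_div, div_le_iff₀ (by positivity)]
      nlinarith
    exact h1.trans ((mul_le_mul_of_nonneg_left h2 (by positivity)).trans h5)
  have hs : Summable fun k => l (k + K) :=
    summable_of_sum_range_le (fun k => (hl _).1) hpart
  exact ⟨(summable_nat_add_iff K).1 hs, hs.tsum_le_of_sum_range_le hpart⟩

/-- Termwise convergence implies convergence of sums dominated by decreasing sequences of lengths
with uniformly bounded `h`-sums. -/
theorem tendsto_tsum_of_antitone (hh : IsMeasureFunction h) {c : ℝ} (hc : 0 ≤ c)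
    {l f : ℕ → ℕ → ℝ} {l' f' : ℕ → ℝ} (hl : ∀ m k, 0 ≤ l m k ∧ l m k ≤ 1)
    (hanti : ∀ m, Antitone (l m)) (hsum : ∀ m n, ∑ k ∈ Finset.range n, h (l m k) ≤ c)
    (hl' : ∀ k, 0 ≤ l' k ∧ l' k ≤ 1)
    (hanti' : Antitone l') (hsum' : ∀ n, ∑ k ∈ Finset.range n, h (l' k) ≤ c)
    (hf : ∀ m k, 0 ≤ f m k ∧ f m k ≤ l m k) (hf' : ∀ k, 0 ≤ f' k ∧ f' k ≤ l' k)
    (hlim : ∀ k, Tendsto (fun m => f m k) atTop (𝓝 (f' k))) :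
    Tendsto (fun m => ∑' k, f m k) atTop (𝓝 (∑' k, f' k)) := by
  rw [Metric.tendsto_nhds]
  intro ε hε
  obtain ⟨K, hK⟩ := hh.exists_tail_le hc (half_pos hε)
  -- The tails beyond `K` of all the sums, including the limit, lie in [0, ε/2]; only finitely many
  -- terms remain to be compared.
  have key : ∀ g p : ℕ → ℝ, (∀ k, 0 ≤ p k ∧ p k ≤ 1) → Antitone p →
      (∀ n, ∑ k ∈ Finset.range n, h (p k) ≤ c) → (∀ k, 0 ≤ g k ∧ g k ≤ p k) →
      0 ≤ ∑' k, g k - ∑ k ∈ Finset.range K, g k ∧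
        ∑' k, g k - ∑ k ∈ Finset.range K, g k ≤ ε / 2 := by
    intro g p hp hpa hps hg
    obtain ⟨hs, ht⟩ := hK p hp hpa hps
    have hgs : Summable g := hs.of_nonneg_of_le (fun k => (hg k).1) fun k => (hg k).2
    rw [← hgs.sum_add_tsum_nat_add K, add_sub_cancel_left]
    exact ⟨tsum_nonneg fun k => (hg _).1,
      (((summable_nat_add_iff K).2 hgs).tsum_le_tsum (fun k => (hg _).2)
        ((summable_nat_add_iff K).2 hs)).trans ht⟩
  have hfin : Tendsto (fun m => ∑ k ∈ Finset.range K, f m k) atTop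
      (𝓝 (∑ k ∈ Finset.range K, f' k)) := tendsto_finsetSum _ fun k _ => hlim k
  filter_upwards [Metric.tendsto_nhds.1 hfin (ε / 2) (half_pos hε)] with m hm
  have h1 := key (f m) (l m) (hl m) (hanti m) (hsum m) (hf m)
  have h2 := key f' l' hl' hanti' hsum' hf'
  rw [Real.dist_eq, abs_lt] at hm ⊢
  constructor <;> linarith [h1.1, h1.2, h2.1, h2.2, hm.1, hm.2]

end IsMeasureFunction

/-! ### Measure covered by disjoint intervals -/

section indicator

variable {S : Set ℝ}

theorem locallyIntegrable_indicator_one (hS : MeasurableSet S) :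
    LocallyIntegrable (S.indicator (fun _ => (1 : ℝ))) volume :=
  (locallyIntegrable_const 1).indicator hS

theorem intervalIntegrable_indicator_one (hS : MeasurableSet S) (a b : ℝ) :
    IntervalIntegrable (S.indicator (fun _ => (1 : ℝ))) volume a b :=
  ((locallyIntegrable_indicator_one hS).integrableOn_isCompact isCompact_uIcc).intervalIntegrable

theorem integral_indicator_one_eq (hS : MeasurableSet S) {a b : ℝ} (hab : a ≤ b) :
    ∫ t in a..b, S.indicator (fun _ => (1 : ℝ)) t = volume.real (S ∩ Ioo a b) := by
  rw [intervalIntegral.integral_of_le hab, integral_Ioc_eq_integral_Ioo,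
    setIntegral_indicator hS, setIntegral_const, smul_eq_mul, mul_one, inter_comm]

theorem integral_indicator_one_bounds (hS : MeasurableSet S) {a b : ℝ} (hab : a ≤ b) :
    0 ≤ ∫ t in a..b, S.indicator (fun _ => (1 : ℝ)) t ∧
      ∫ t in a..b, S.indicator (fun _ => (1 : ℝ)) t ≤ b - a := by
  rw [integral_indicator_one_eq hS hab]
  refine ⟨measureReal_nonneg, (measureReal_mono inter_subset_right (by simp)).trans ?_⟩
  rw [Real.volume_real_Ioo_of_le hab]

theorem tendsto_integral_indicator_one (hS : MeasurableSet S) {a b : ℕ → ℝ} {a' b' : ℝ}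
    (ha : Tendsto a atTop (𝓝 a')) (hb : Tendsto b atTop (𝓝 b')) :
    Tendsto (fun m => ∫ t in a m..b m, S.indicator (fun _ => (1 : ℝ)) t) atTop
      (𝓝 (∫ t in a'..b', S.indicator (fun _ => (1 : ℝ)) t)) := by
  have hi := intervalIntegrable_indicator_one hS
  have hc := intervalIntegral.continuous_primitive hi 0
  have h1 := ((hc.tendsto b').comp hb).sub ((hc.tendsto a').comp ha)
  rw [intervalIntegral.integral_interval_sub_left (hi _ _) (hi _ _)] at h1
  refine h1.congr fun m => ?_
  exact intervalIntegral.integral_interval_sub_left (hi _ _) (hi _ _)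

/-- Countable additivity. The uncovered part enters the cost of a path, while the covered part is a
series whose limit can be taken termwise. -/
theorem hasSum_integral_indicator_one (hS : MeasurableSet S) {a b : ℕ → ℝ}
    (hab : ∀ k, 0 ≤ a k ∧ a k ≤ b k ∧ b k ≤ 1)
    (hd : Pairwise fun i j => Disjoint (Ioo (a i) (b i)) (Ioo (a j) (b j))) :
    HasSum (fun k => ∫ t in a k..b k, S.indicator (fun _ => (1 : ℝ)) t)
      ((∫ t in (0 : ℝ)..1, S.indicator (fun _ => (1 : ℝ)) t) -
        volume.real ((S ∩ Ioo 0 1) \ ⋃ k, Ioo (a k) (b k))) := by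
  simp only [fun k => integral_indicator_one_eq hS (hab k).2.1]
  rw [integral_indicator_one_eq hS (zero_le_one' ℝ)]
  have hU : MeasurableSet (⋃ k, S ∩ Ioo (a k) (b k)) :=
    MeasurableSet.iUnion fun k => hS.inter measurableSet_Ioo
  have hsub : (⋃ k, S ∩ Ioo (a k) (b k)) ⊆ S ∩ Ioo 0 1 :=
    iUnion_subset fun k => inter_subset_inter_right _ (Ioo_subset_Ioo (hab k).1 (hab k).2.2)
  have hfin : volume (S ∩ Ioo 0 1) ≠ ⊤ := measure_ne_top_of_subset inter_subset_right (by simp)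
  have hdiff : (S ∩ Ioo 0 1) \ ⋃ k, Ioo (a k) (b k) =
      (S ∩ Ioo 0 1) \ ⋃ k, S ∩ Ioo (a k) (b k) := by
    rw [← inter_iUnion]
    ext t
    simp only [Set.mem_sdiff, mem_inter_iff]
    tauto
  have h1 : volume.real (S ∩ Ioo 0 1) - volume.real ((S ∩ Ioo 0 1) \ ⋃ k, Ioo (a k) (b k)) =
      volume.real (⋃ k, S ∩ Ioo (a k) (b k)) := by
    rw [hdiff, measureReal_sdiff hsub hU hfin]
    ring
  rw [h1]
  have hd' : Pairwise (Function.onFun Disjoint fun k => S ∩ Ioo (a k) (b k)) := fun i j hij =>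
    (hd hij).mono inter_subset_right inter_subset_right
  have hm := measure_iUnion (μ := volume) hd' fun k => hS.inter measurableSet_Ioo
  have hne : ∑' k, volume (S ∩ Ioo (a k) (b k)) ≠ ⊤ := by
    rw [← hm]
    exact measure_ne_top_of_subset hsub hfin
  rw [measureReal_def, hm, ENNReal.tsum_toReal_eq (ENNReal.ne_top_of_tsum_ne_top hne)]
  exact ENNReal.hasSum_toReal hne

end indicator

/-! ### Compactness: nonnegative costs for large M -/

/-- If every open subset `U` of `(0, 1)` with summable `h`-lengths which covers almost all of `P`
covers almost all of `R`, then for large `M` all paths from `0` to `1` have nonnegative cost. -/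
theorem exists_pathCost_nonneg {h : ℝ → ℝ} (hh : IsMeasureFunction h) {R P : Set ℝ}
    (hR : MeasurableSet R) (hP : MeasurableSet P) {c : ℝ} (hc : 0 ≤ c)
    (H : ∀ a b : ℕ → ℝ, (∀ k, 0 ≤ a k ∧ a k ≤ b k ∧ b k ≤ 1) →
      (Pairwise fun i j => Disjoint (Ioo (a i) (b i)) (Ioo (a j) (b j))) →
      Summable (fun k => h (b k - a k)) →
      volume ((P ∩ Ioo 0 1) \ ⋃ k, Ioo (a k) (b k)) = 0 →
      volume ((R ∩ Ioo 0 1) \ ⋃ k, Ioo (a k) (b k)) = 0) :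
    ∃ M : ℝ, 0 ≤ M ∧ ∀ v, PathCost h
      (fun t => M * P.indicator (fun _ => (1 : ℝ)) t - c * R.indicator (fun _ => (1 : ℝ)) t) 1 v →
      0 ≤ v := by
  by_contra! hcon
  set iP := P.indicator (fun _ => (1 : ℝ))
  set iR := R.indicator (fun _ => (1 : ℝ))
  have hiP := intervalIntegrable_indicator_one hP
  have hiR := intervalIntegrable_indicator_one hR
  -- A negative path for M = m + 1, with its cost written through the uncovered parts of P and R.
  -- The series run over all `k` since the padding contributes nothing.
  have hstep : ∀ m : ℕ, ∃ (n : ℕ) (a b : ℕ → ℝ), (∀ k, 0 ≤ a k ∧ a k ≤ b k ∧ b k ≤ 1) ∧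
      (Pairwise fun i j => Disjoint (Ioo (a i) (b i)) (Ioo (a j) (b j))) ∧
      Antitone (fun k => b k - a k) ∧ (∀ k, n ≤ k → a k = 0 ∧ b k = 0) ∧
      ∑ k ∈ Finset.range n, h (b k - a k) +
        ((m : ℝ) + 1) * ((∫ t in (0 : ℝ)..1, iP t) - ∑' k, ∫ t in a k..b k, iP t) <
      c * ((∫ t in (0 : ℝ)..1, iR t) - ∑' k, ∫ t in a k..b k, iR t) := by
    intro m
    obtain ⟨v, p, hv⟩ := hcon (m + 1) (by positivity)
    have hu : ∀ x y, IntervalIntegrable (fun t => ((m : ℝ) + 1) * iP t - c * iR t) volume x y :=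
      fun x y => ((hiP x y).const_mul _).sub ((hiR x y).const_mul _)
    obtain ⟨n, a, b, hab, hd, hanti, hn, rfl⟩ := p.exists_antitone_seq hu
    refine ⟨n, a, b, hab, hd, hanti, hn, ?_⟩
    have hts : ∀ g : ℝ → ℝ, ∑' k, ∫ t in a k..b k, g t =
        ∑ k ∈ Finset.range n, ∫ t in a k..b k, g t := fun g =>
      tsum_eq_sum fun k hk => by
        rw [Finset.mem_range, not_lt] at hk
        rw [(hn k hk).1, (hn k hk).2, intervalIntegral.integral_same]
    have hint : ∀ x y, ∫ t in x..y, (((m : ℝ) + 1) * iP t - c * iR t) =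
        ((m : ℝ) + 1) * (∫ t in x..y, iP t) - c * ∫ t in x..y, iR t := fun x y => by
      rw [intervalIntegral.integral_sub ((hiP x y).const_mul _) ((hiR x y).const_mul _),
        intervalIntegral.integral_const_mul, intervalIntegral.integral_const_mul]
    simp only [hint, Finset.sum_sub_distrib, ← Finset.mul_sum] at hv
    rw [hts, hts]
    linarith
  choose n a b hab hd hanti hn hlt using hstep
  have hl : ∀ m k, 0 ≤ b m k - a m k ∧ b m k - a m k ≤ 1 := fun m k =>
    ⟨by linarith [(hab m k).2.1], by linarith [(hab m k).1, (hab m k).2.2]⟩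
  have hP0 : ∀ m, 0 ≤ (∫ t in (0 : ℝ)..1, iP t) - ∑' k, ∫ t in a m k..b m k, iP t := fun m => by
    rw [(hasSum_integral_indicator_one hP (hab m) (hd m)).tsum_eq, sub_sub_cancel]
    exact measureReal_nonneg
  have hR0 : ∀ m, 0 ≤ ∑' k, ∫ t in a m k..b m k, iR t := fun m =>
    tsum_nonneg fun k => (integral_indicator_one_bounds hR (hab m k).2.1).1
  have hR1 : ∫ t in (0 : ℝ)..1, iR t ≤ 1 := by
    simpa using (integral_indicator_one_bounds hR (zero_le_one' ℝ)).2
  have hS0 : ∀ m, 0 ≤ ∑ k ∈ Finset.range (n m), h (b m k - a m k) := fun m =>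
    Finset.sum_nonneg fun k _ => hh.nonneg (hl m k).1 (hl m k).2
  have hRc : ∀ m, c * ((∫ t in (0 : ℝ)..1, iR t) - ∑' k, ∫ t in a m k..b m k, iR t) ≤ c :=
    fun m => mul_le_of_le_one_right hc (by linarith [hR0 m])
  have hPm : ∀ m : ℕ, 0 ≤ ((m : ℝ) + 1) *
      ((∫ t in (0 : ℝ)..1, iP t) - ∑' k, ∫ t in a m k..b m k, iP t) :=
    fun m => mul_nonneg (by positivity) (hP0 m)
  have hSN : ∀ m N, ∑ k ∈ Finset.range N, h (b m k - a m k) ≤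
      ∑ k ∈ Finset.range (n m), h (b m k - a m k) := by
    intro m N
    refine (Finset.sum_le_sum_of_subset_of_nonneg (Finset.range_mono (le_max_left N (n m)))
      fun k _ _ => hh.nonneg (hl m k).1 (hl m k).2).trans (le_of_eq ?_)
    refine (Finset.sum_subset (Finset.range_mono (le_max_right N (n m))) fun k _ hk => ?_).symm
    rw [Finset.mem_range, not_lt] at hk
    rw [(hn m k hk).1, (hn m k hk).2, sub_zero, hh.map_zero]
  have hsum : ∀ m N, ∑ k ∈ Finset.range N, h (b m k - a m k) ≤ c := fun m N => by
    linarith [hSN m N, hlt m, hRc m, hPm m]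
  -- passing to the limit along a subsequence
  have hcomp : IsCompact (Set.pi univ fun _ : ℕ => (Icc 0 1 ×ˢ Icc 0 1 : Set (ℝ × ℝ))) :=
    isCompact_univ_pi fun _ => isCompact_Icc.prod isCompact_Icc
  obtain ⟨z, -, φ, hφ, hz⟩ := hcomp.tendsto_subseq (x := fun m k => (a m k, b m k)) fun m k _ =>
    ⟨⟨(hab m k).1, (hab m k).2.1.trans (hab m k).2.2⟩,
      ⟨(hab m k).1.trans (hab m k).2.1, (hab m k).2.2⟩⟩
  rw [tendsto_pi_nhds] at hz
  set a' : ℕ → ℝ := fun k => (z k).1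
  set b' : ℕ → ℝ := fun k => (z k).2
  have ha' : ∀ k, Tendsto (fun m => a (φ m) k) atTop (𝓝 (a' k)) := fun k =>
    (continuous_fst.tendsto _).comp (hz k)
  have hb' : ∀ k, Tendsto (fun m => b (φ m) k) atTop (𝓝 (b' k)) := fun k =>
    (continuous_snd.tendsto _).comp (hz k)
  have hlim : ∀ k, Tendsto (fun m => b (φ m) k - a (φ m) k) atTop (𝓝 (b' k - a' k)) := fun k =>
    (hb' k).sub (ha' k)
  have hab' : ∀ k, 0 ≤ a' k ∧ a' k ≤ b' k ∧ b' k ≤ 1 := fun k =>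
    ⟨ge_of_tendsto' (ha' k) fun m => (hab _ k).1,
      le_of_tendsto_of_tendsto' (ha' k) (hb' k) fun m => (hab _ k).2.1,
      le_of_tendsto' (hb' k) fun m => (hab _ k).2.2⟩
  have hl' : ∀ k, 0 ≤ b' k - a' k ∧ b' k - a' k ≤ 1 := fun k =>
    ⟨by linarith [(hab' k).2.1], by linarith [(hab' k).1, (hab' k).2.2]⟩
  have hd' : Pairwise fun i j => Disjoint (Ioo (a' i) (b' i)) (Ioo (a' j) (b' j)) := by
    intro i j hij
    -- Disjointness becomes a non-strict inequality between endpoints, which survives the limit.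
    rw [Ioo_disjoint_Ioo]
    exact le_of_tendsto_of_tendsto' ((hb' i).min (hb' j)) ((ha' i).max (ha' j)) fun m =>
      Ioo_disjoint_Ioo.1 (hd (φ m) hij)
  have hanti' : Antitone fun k => b' k - a' k := fun i j hij =>
    le_of_tendsto_of_tendsto' (hlim j) (hlim i) fun m => hanti (φ m) hij
  have hhlim : ∀ k, Tendsto (fun m => h (b (φ m) k - a (φ m) k)) atTop
      (𝓝 (h (b' k - a' k))) := fun k =>
    (hh.continuousOn (b' k - a' k) (hl' k)).tendsto.comp
      (tendsto_nhdsWithin_iff.2 ⟨hlim k, Eventually.of_forall fun m => hl (φ m) k⟩)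
  have hsum' : ∀ N, ∑ k ∈ Finset.range N, h (b' k - a' k) ≤ c := fun N =>
    le_of_tendsto' (tendsto_finsetSum _ fun k _ => hhlim k) fun m => hsum (φ m) N
  have htsum : ∀ S : Set ℝ, MeasurableSet S → Tendsto
      (fun m => ∑' k, ∫ t in a (φ m) k..b (φ m) k, S.indicator (fun _ => (1 : ℝ)) t) atTop
      (𝓝 (∑' k, ∫ t in a' k..b' k, S.indicator (fun _ => (1 : ℝ)) t)) := fun S hS =>
    hh.tendsto_tsum_of_antitone hc (fun m => hl (φ m)) (fun m => hanti (φ m))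
      (fun m => hsum (φ m)) hl' hanti' hsum'
      (fun m k => integral_indicator_one_bounds hS (hab (φ m) k).2.1)
      (fun k => integral_indicator_one_bounds hS (hab' k).2.1)
      fun k => tendsto_integral_indicator_one hS (ha' k) (hb' k)
  have hPlim := (htsum P hP).const_sub (∫ t in (0 : ℝ)..1, iP t)
  have hRlim := ((htsum R hR).const_sub (∫ t in (0 : ℝ)..1, iR t)).const_mul c
  have hPle : (∫ t in (0 : ℝ)..1, iP t) - ∑' k, ∫ t in a' k..b' k, iP t ≤ 0 := by
    have h1 : Tendsto (fun m => c * (1 / ((φ m : ℝ) + 1))) atTop (𝓝 0) := by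
      simpa using (tendsto_one_div_add_atTop_nhds_zero_nat.comp hφ.tendsto_atTop).const_mul c
    refine le_of_tendsto_of_tendsto' hPlim h1 fun m => ?_
    rw [mul_one_div, le_div_iff₀ (by positivity)]
    linarith [hlt (φ m), hRc (φ m), hS0 (φ m)]
  have hPnull : volume ((P ∩ Ioo 0 1) \ ⋃ k, Ioo (a' k) (b' k)) = 0 := by
    rw [(hasSum_integral_indicator_one hP hab' hd').tsum_eq, sub_sub_cancel] at hPle
    refine (measureReal_eq_zero_iff ?_).1 (le_antisymm hPle measureReal_nonneg)
    exact measure_ne_top_of_subset (sdiff_subset.trans inter_subset_right) (by simp)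
  have hRnull := H a' b' hab' hd' (summable_of_sum_range_le
    (fun k => hh.nonneg (hl' k).1 (hl' k).2) hsum') hPnull
  have hReq : ∑' k, ∫ t in a' k..b' k, iR t = ∫ t in (0 : ℝ)..1, iR t := by
    rw [(hasSum_integral_indicator_one hR hab' hd').tsum_eq, measureReal_def, hRnull,
      ENNReal.toReal_zero, sub_zero]
  -- Each h(l_k) is at most c times the uncovered measure of R, which tends to 0 along the
  -- subsequence; `h` is positive at positive lengths.
  have hzero : ∀ k, b' k - a' k = 0 := by
    intro k
    have h1 : h (b' k - a' k) ≤ 0 := by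
      have h2 : c * ((∫ t in (0 : ℝ)..1, iR t) - ∑' k, ∫ t in a' k..b' k, iR t) = 0 := by
        rw [hReq, sub_self, mul_zero]
      rw [← h2]
      refine le_of_tendsto_of_tendsto' (hhlim k) hRlim fun m => ?_
      have h3 := Finset.single_le_sum (f := fun k => h (b (φ m) k - a (φ m) k))
        (fun i _ => hh.nonneg (hl (φ m) i).1 (hl (φ m) i).2) (Finset.self_mem_range_succ k)
      have h4 : h (b (φ m) k - a (φ m) k) ≤ _ := h3.trans (hSN (φ m) _)
      linarith [hlt (φ m), hPm (φ m)]
    by_contra hne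
    exact absurd (hh.pos (lt_of_le_of_ne (hl' k).1 (Ne.symm hne)) (hl' k).2) (not_lt.2 h1)
  have hR00 : ∫ t in (0 : ℝ)..1, iR t = 0 := by
    rw [← hReq]
    refine (tsum_congr fun k => ?_).trans tsum_zero
    rw [sub_eq_zero.1 (hzero k), intervalIntegral.integral_same]
  -- With R null in (0, 1), already the strict inequality for m = 0 fails: its left side is
  -- nonnegative.
  have := hlt 0
  rw [hR00, zero_sub, mul_neg] at this
  linarith [mul_nonneg hc (hR0 0), hS0 0, hPm 0]

/-! ### Bounded density with mean zero -/

/-- The real-line form of the construction. -/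
theorem exists_bounded_density {h : ℝ → ℝ} (hh : IsMeasureFunction h) {R P : Set ℝ}
    (hR : MeasurableSet R) (hP : MeasurableSet P) (hRP : Disjoint R P) {c : ℝ} (hc : 0 ≤ c)
    (H : ∀ a b : ℕ → ℝ, (∀ k, 0 ≤ a k ∧ a k ≤ b k ∧ b k ≤ 1) →
      (Pairwise fun i j => Disjoint (Ioo (a i) (b i)) (Ioo (a j) (b j))) →
      Summable (fun k => h (b k - a k)) →
      volume ((P ∩ Ioo 0 1) \ ⋃ k, Ioo (a k) (b k)) = 0 →
      volume ((R ∩ Ioo 0 1) \ ⋃ k, Ioo (a k) (b k)) = 0) :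
    ∃ g : ℝ → ℝ, Measurable g ∧ (∃ B, ∀ t, |g t| ≤ B) ∧ (∀ t ∈ R, g t = -c) ∧
      (∀ t, t ∉ R → t ∉ P → g t = 0) ∧
      (∀ x y, 0 ≤ x → x ≤ y → y ≤ 1 → ∫ t in x..y, g t ≤ h (y - x)) ∧
      ∫ t in (0 : ℝ)..1, g t = 0 := by
  obtain ⟨M, hM, hpos⟩ := exists_pathCost_nonneg hh hR hP hc H
  set iP := P.indicator (fun _ => (1 : ℝ)) with hiPdef
  set iR := R.indicator (fun _ => (1 : ℝ)) with hiRdef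
  have mP : Measurable iP := measurable_const.indicator hP
  have mR : Measurable iR := measurable_const.indicator hR
  have bP : ∀ t, 0 ≤ iP t ∧ iP t ≤ 1 := fun t => by
    by_cases ht : t ∈ P <;> simp [hiPdef, ht]
  have bR : ∀ t, 0 ≤ iR t ∧ iR t ≤ 1 := fun t => by
    by_cases ht : t ∈ R <;> simp [hiRdef, ht]
  have hMP : ∀ t, 0 ≤ M * iP t ∧ M * iP t ≤ M := fun t =>
    ⟨mul_nonneg hM (bP t).1, mul_le_of_le_one_right hM (bP t).2⟩
  have hcR : ∀ t, 0 ≤ c * iR t ∧ c * iR t ≤ c := fun t =>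
    ⟨mul_nonneg hc (bR t).1, mul_le_of_le_one_right hc (bR t).2⟩
  obtain ⟨f, hf, hfh, hf1, hfb⟩ := exists_density_le (h := h)
    (u := fun t => M * iP t - c * iR t) (w := fun t => c * iR t) (C := M + c) hh
    (fun t => (hcR t).1) (fun t => by linarith [(hMP t).1])
    ((mP.const_mul M).sub (mR.const_mul c)) (mR.const_mul c)
    (fun t => abs_le.2 ⟨by linarith [hMP t, hcR t], by linarith [hMP t, hcR t]⟩)
    (fun t => abs_le.2 ⟨by linarith [hMP t, hcR t], by linarith [hMP t, hcR t]⟩) hpos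
  -- The bounds on `f` hold only almost everywhere in (0, 1). Clamping to [0, M] on P and restarting
  -- from exact values elsewhere makes them hold everywhere.
  set p : ℝ → ℝ := P.indicator fun t => max 0 (min M (f t)) with hpdef
  have mp : Measurable p := (measurable_const.max (measurable_const.min hf)).indicator hP
  have bp : ∀ t, 0 ≤ p t ∧ p t ≤ M := fun t => by
    by_cases ht : t ∈ P <;> simp [hpdef, ht, hM]
  have hpf : ∀ᵐ t, t ∈ Ioo (0 : ℝ) 1 → f t = p t - c * iR t := by
    filter_upwards [hfb] with t ht ht1
    obtain ⟨h1, h2⟩ := ht ht1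
    by_cases htP : t ∈ P
    · have htR : t ∉ R := fun h => Set.disjoint_left.1 hRP h htP
      simp only [hpdef, hiPdef, hiRdef, htP, htR, indicator_of_mem, indicator_of_notMem,
        not_false_eq_true, mul_one, mul_zero, sub_zero, neg_zero] at h1 h2 ⊢
      rw [min_eq_right h2, max_eq_right h1]
    · simp only [hpdef, hiPdef, htP, indicator_of_notMem, not_false_eq_true, mul_zero,
        zero_sub] at h1 h2 ⊢
      linarith
  have hint : ∀ g : ℝ → ℝ, Measurable g → ∀ C, (∀ t, |g t| ≤ C) →
      ∀ x y, IntervalIntegrable g volume x y := fun g hg C hgC x y =>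
    (((memLp_top_of_bound hg.aestronglyMeasurable C (ae_of_all _ hgC)).locallyIntegrable
      le_top).integrableOn_isCompact isCompact_uIcc).intervalIntegrable
  have ip := hint p mp M fun t => abs_le.2 ⟨by linarith [bp t], (bp t).2⟩
  have iiR := hint iR mR 1 fun t => abs_le.2 ⟨by linarith [bR t], (bR t).2⟩
  have hfint : ∀ x y, 0 ≤ x → x ≤ y → y ≤ 1 →
      ∫ t in x..y, f t = (∫ t in x..y, p t) - c * ∫ t in x..y, iR t := by
    intro x y hx hxy hy
    rw [← intervalIntegral.integral_const_mul,
      ← intervalIntegral.integral_sub (ip x y) ((iiR x y).const_mul c)]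
    refine intervalIntegral.integral_congr_ae ?_
    have h1 : ∀ᵐ t : ℝ, t ≠ 1 := by simp [ae_iff, measure_singleton]
    filter_upwards [hpf, h1] with t ht ht1 htxy
    rw [uIoc_of_le hxy] at htxy
    exact ht ⟨hx.trans_lt htxy.1, lt_of_le_of_ne (htxy.2.trans hy) ht1⟩
  have hp0 : ∀ x y, x ≤ y → 0 ≤ ∫ t in x..y, p t := fun x y hxy =>
    intervalIntegral.integral_nonneg hxy fun t _ => (bp t).1
  -- Scaling the positive part by θ balances the mass on R; θ ≤ 1 only decreases integrals, so the
  -- bound by `h` persists.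
  obtain ⟨θ, hθ0, hθ1, hθ⟩ : ∃ θ : ℝ, 0 ≤ θ ∧ θ ≤ 1 ∧
      θ * (∫ t in (0 : ℝ)..1, p t) = c * ∫ t in (0 : ℝ)..1, iR t := by
    have h1 : c * ∫ t in (0 : ℝ)..1, iR t ≤ ∫ t in (0 : ℝ)..1, p t := by
      linarith [hfint 0 1 le_rfl zero_le_one le_rfl]
    have h2 : 0 ≤ c * ∫ t in (0 : ℝ)..1, iR t :=
      mul_nonneg hc (intervalIntegral.integral_nonneg zero_le_one fun t _ => (bR t).1)
    rcases (hp0 0 1 zero_le_one).eq_or_lt with h3 | h3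
    · exact ⟨0, le_rfl, zero_le_one, by linarith⟩
    · exact ⟨_, div_nonneg h2 h3.le, (div_le_one h3).2 h1, div_mul_cancel₀ _ h3.ne'⟩
  have hgint : ∀ x y, ∫ t in x..y, (θ * p t - c * iR t) =
      θ * (∫ t in x..y, p t) - c * ∫ t in x..y, iR t := fun x y => by
    rw [intervalIntegral.integral_sub ((ip x y).const_mul _) ((iiR x y).const_mul _),
      intervalIntegral.integral_const_mul, intervalIntegral.integral_const_mul]
  refine ⟨fun t => θ * p t - c * iR t, (mp.const_mul θ).sub (mR.const_mul c),
    ⟨M + c, fun t => ?_⟩, fun t ht => ?_, fun t htR htP => ?_, fun x y hx hxy hy => ?_, ?_⟩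
  · have h1 := mul_nonneg hθ0 (bp t).1
    have h2 := mul_le_of_le_one_left (bp t).1 hθ1
    exact abs_le.2 ⟨by linarith [hcR t], by linarith [hcR t, bp t]⟩
  · have htP : t ∉ P := fun h => Set.disjoint_left.1 hRP ht h
    simp [hpdef, hiRdef, ht, htP]
  · simp [hpdef, hiRdef, htR, htP]
  · rw [hgint]
    have := hfh x y hx hxy hy
    rw [hfint x y hx hxy hy] at this
    linarith [mul_le_of_le_one_left (hp0 x y hxy) hθ1]
  · rw [hgint, hθ, sub_self]

/-! ### Transfer between the line and the circle -/

theorem injOn_coe_Ioc (a : ℝ) :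
    InjOn (fun t : ℝ => (t : UnitAddCircle)) (Ioc a (a + 1)) := by
  intro x hx y hy hxy
  rw [← AddCircle.equivIoc_coe_of_mem (p := (1 : ℝ)) hx,
    ← AddCircle.equivIoc_coe_of_mem (p := (1 : ℝ)) hy]
  exact congrArg (fun z => ((AddCircle.equivIoc (1 : ℝ) a z : Ioc a (a + 1)) : ℝ)) hxy

theorem isOpen_coe_image_Ioo (a b : ℝ) :
    IsOpen ((fun t : ℝ => (t : UnitAddCircle)) '' Ioo a b) :=
  QuotientAddGroup.isOpenMap_coe _ isOpen_Ioo

theorem UnitAddCircle.volume_singleton (x : UnitAddCircle) : volume {x} = 0 := by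
  rw [← Metric.closedBall_zero, AddCircle.volume_closedBall]
  simp

theorem coe_image_ae_eq {a b : ℝ} {J : Set ℝ} (h1 : Ioo a b ⊆ J) (h2 : J ⊆ Icc a b) :
    (fun t : ℝ => (t : UnitAddCircle)) '' J =ᵐ[volume]
      (fun t : ℝ => (t : UnitAddCircle)) '' Ioo a b := by
  have h0 : volume ({(a : UnitAddCircle)} ∪ {(b : UnitAddCircle)}) = 0 :=
    measure_union_null (UnitAddCircle.volume_singleton _) (UnitAddCircle.volume_singleton _)
  refine ae_eq_set.2 ⟨measure_mono_null ?_ h0, ?_⟩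
  · rintro _ ⟨⟨t, ht, rfl⟩, hn⟩
    rcases (h2 ht).1.eq_or_lt with rfl | hat
    · exact Or.inl rfl
    rcases (h2 ht).2.eq_or_lt with rfl | htb
    · exact Or.inr rfl
    exact (hn ⟨t, ⟨hat, htb⟩, rfl⟩).elim
  · rw [sdiff_eq_empty.2 (image_mono h1), measure_empty]

/-- Cutting the circle at `a` places the whole arc in one fundamental domain; its endpoints are
null. -/
theorem setIntegral_arc {a b : ℝ} (hab : a ≤ b) (hb : b ≤ a + 1) {J : Set ℝ} (h1 : Ioo a b ⊆ J)
    (h2 : J ⊆ Icc a b) (f : UnitAddCircle → ℝ) :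
    ∫ x in (fun t : ℝ => (t : UnitAddCircle)) '' J, f x = ∫ t in a..b, f t := by
  have hm := (isOpen_coe_image_Ioo a b).measurableSet
  have hpre : Ioc a (a + 1) ∩ (fun t : ℝ => (t : UnitAddCircle)) ⁻¹'
      ((fun t : ℝ => (t : UnitAddCircle)) '' Ioo a b) = Ioo a b := by
    ext t
    constructor
    · rintro ⟨ht, s, hs, hst⟩
      have := injOn_coe_Ioc a ⟨hs.1, hs.2.le.trans hb⟩ ht hst
      exact this ▸ hs
    · exact fun ht => ⟨⟨ht.1, ht.2.le.trans hb⟩, mem_image_of_mem _ ht⟩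
  have hm' : MeasurableSet ((fun t : ℝ => (t : UnitAddCircle)) ⁻¹'
      ((fun t : ℝ => (t : UnitAddCircle)) '' Ioo a b)) := AddCircle.measurable_mk' hm
  rw [setIntegral_congr_set (coe_image_ae_eq h1 h2), ← integral_indicator hm,
    ← UnitAddCircle.integral_preimage a, intervalIntegral.integral_of_le hab,
    integral_Ioc_eq_integral_Ioo (x := a) (y := b)]
  conv_rhs => rw [← hpre, ← setIntegral_indicator hm']
  rfl

theorem volume_real_arc {a b : ℝ} (hab : a ≤ b) (hb : b ≤ a + 1) {J : Set ℝ} (h1 : Ioo a b ⊆ J)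
    (h2 : J ⊆ Icc a b) :
    volume.real ((fun t : ℝ => (t : UnitAddCircle)) '' J) = b - a := by
  simpa using setIntegral_arc hab hb h1 h2 fun _ => 1

theorem UnitAddCircle.volume_eq {S : Set UnitAddCircle} (hS : MeasurableSet S) :
    volume S = volume ((fun t : ℝ => (t : UnitAddCircle)) ⁻¹' S ∩ Ioc 0 1) := by
  have h1 := (UnitAddCircle.measurePreserving_mk 0).measure_preimage hS.nullMeasurableSet
  rw [Measure.restrict_apply (AddCircle.measurable_mk' hS), zero_add] at h1
  exact h1.symm

/-- An open subset of `(0, 1)` with summable `h`-lengths is the trace of the complement of an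
`h`-Carleson set. -/
theorem isHCarleson_compl_iUnion {h : ℝ → ℝ} {a b : ℕ → ℝ}
    (hab : ∀ k, 0 ≤ a k ∧ a k ≤ b k ∧ b k ≤ 1)
    (hd : Pairwise fun i j => Disjoint (Ioo (a i) (b i)) (Ioo (a j) (b j)))
    (hs : Summable fun k => h (b k - a k)) :
    IsHCarleson h (⋃ k, (fun t : ℝ => (t : UnitAddCircle)) '' Ioo (a k) (b k))ᶜ := by
  set I : ℕ → Set UnitAddCircle := fun k => (fun t : ℝ => (t : UnitAddCircle)) '' Ioo (a k) (b k)
  have hI : ∀ k, IsOpen (I k) := fun k => isOpen_coe_image_Ioo _ _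
  have hb : ∀ k, b k ≤ a k + 1 := fun k => by linarith [(hab k).1, (hab k).2.2]
  have hsub : ∀ k, Ioo (a k) (b k) ⊆ Ioc 0 (0 + 1) := fun k t ht =>
    ⟨(hab k).1.trans_lt ht.1, by linarith [ht.2, (hab k).2.2]⟩
  have hdI : ∀ i j, i ≠ j → Disjoint (I i) (I j) := fun i j hij =>
    Set.disjoint_image_image fun s hs t ht hst =>
      Set.disjoint_left.1 (hd hij) hs (injOn_coe_Ioc 0 (hsub i hs) (hsub j ht) hst ▸ ht)
  refine ⟨(isOpen_iUnion hI).isClosed_compl, range I, ?_, ?_, ?_, ?_⟩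
  · rintro _ ⟨k, rfl⟩
    exact ⟨hI k, a k, b k, _, (hab k).2.1, hb k, le_rfl, Ioo_subset_Icc_self, rfl⟩
  · rintro _ ⟨i, rfl⟩ _ ⟨j, rfl⟩ hij
    exact hdI i j fun h => hij (congrArg I h)
  · rw [compl_compl, sUnion_range]
  -- Several indices may give the same (empty) arc, so each arc gets one chosen index, and
  -- summability passes to a subfamily.
  · choose k hk using fun ℓ : range I => ℓ.2
    have hinj : Function.Injective k := fun ℓ ℓ' hℓ =>
      Subtype.ext ((hk ℓ).symm.trans ((congrArg I hℓ).trans (hk ℓ')))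
    refine (hs.comp_injective hinj).congr fun ℓ => ?_
    rw [← hk ℓ, volume_real_arc (hab _).2.1 (hb _) le_rfl Ioo_subset_Icc_self]
    rfl

/-- The factor 2 is the price of cutting the circle at 0: an arc through 0 splits into two
intervals, each bounded by `h` of the full length. -/
theorem exists_function_circle {h : ℝ → ℝ} (hh : IsMeasureFunction h) {R P : Set UnitAddCircle}
    (hR : MeasurableSet R) (hP : MeasurableSet P) (hRP : Disjoint R P)
    (H : ∀ A, IsHCarleson h A → volume (A ∩ P) = 0 → volume (A ∩ R) = 0) {c : ℝ} (hc : 0 ≤ c) :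
    ∃ f : UnitAddCircle → ℝ, Measurable f ∧ (∃ B, ∀ x, |f x| ≤ B) ∧
      (∀ Δ, IsArc Δ → ∫ x in Δ, f x ≤ 2 * h (volume.real Δ)) ∧ ∫ x, f x = 0 ∧
      (∀ x ∈ R, f x = -c) ∧ ∀ x, x ∉ R → x ∉ P → f x = 0 := by
  set π : ℝ → UnitAddCircle := fun t => (t : UnitAddCircle)
  have hπ : Measurable π := AddCircle.measurable_mk'
  obtain ⟨g, hg, ⟨B, hB⟩, hgR, hg0, hgh, hg1⟩ := exists_bounded_density hh (hπ hR) (hπ hP)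
    (hRP.preimage π) hc (by
      intro a b hab hd hs hPn
      have hA := isHCarleson_compl_iUnion hab hd hs
      set A := (⋃ k, π '' Ioo (a k) (b k))ᶜ
      have hAR := H A hA (by
        rw [UnitAddCircle.volume_eq (hA.1.measurableSet.inter hP)]
        refine measure_mono_null ?_ (measure_union_null hPn (Real.volume_singleton (a := 1)))
        rintro t ⟨⟨htA, htP⟩, ht⟩
        rcases ht.2.eq_or_lt with rfl | ht1
        · exact Or.inr rfl
        · refine Or.inl ⟨⟨htP, ht.1, ht1⟩, fun htU => htA ?_⟩
          obtain ⟨k, hk⟩ := mem_iUnion.1 htU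
          exact mem_iUnion.2 ⟨k, mem_image_of_mem _ hk⟩)
      rw [UnitAddCircle.volume_eq (hA.1.measurableSet.inter hR)] at hAR
      refine measure_mono_null ?_ hAR
      rintro t ⟨⟨htR, ht⟩, htU⟩
      refine ⟨⟨fun htA => htU ?_, htR⟩, ht.1, ht.2.le⟩
      obtain ⟨k, s, hs, hst⟩ := mem_iUnion.1 htA
      have := injOn_coe_Ioc 0 ⟨(hab k).1.trans_lt hs.1, by linarith [hs.2, (hab k).2.2]⟩
        ⟨ht.1, by linarith [ht.2]⟩ hst
      exact mem_iUnion.2 ⟨k, this ▸ hs⟩)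
  set r : UnitAddCircle → ℝ := fun x => (AddCircle.equivIoc (1 : ℝ) 0 x : ℝ)
  have hr : Measurable r := measurable_subtype_coe.comp (AddCircle.measurableEquivIoc 1 0).measurable
  have hπr : ∀ x, π (r x) = x := fun x => AddCircle.coe_equivIoc
  have hrπ : ∀ t ∈ Ioc (0 : ℝ) 1, r (π t) = t := fun t ht =>
    AddCircle.equivIoc_coe_of_mem (p := (1 : ℝ)) (by rwa [zero_add])
  set f : UnitAddCircle → ℝ := fun x => g (r x)
  have hf : Measurable f := hg.comp hr
  have hfg : ∀ x y, 0 ≤ x → x ≤ y → y ≤ 1 → ∫ t in x..y, f (π t) = ∫ t in x..y, g t := by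
    intro x y hx hxy hy
    refine intervalIntegral.integral_congr_ae (ae_of_all _ fun t ht => ?_)
    rw [uIoc_of_le hxy] at ht
    exact congrArg g (hrπ t ⟨hx.trans_lt ht.1, ht.2.trans hy⟩)
  have hfi : ∀ x y, IntervalIntegrable (fun t => f (π t)) volume x y := fun x y =>
    (((memLp_top_of_bound (hf.comp hπ).aestronglyMeasurable B
      (ae_of_all _ fun t => hB _)).locallyIntegrable
      le_top).integrableOn_isCompact isCompact_uIcc).intervalIntegrable
  have hper : ∀ (n : ℤ) (t : ℝ), π (t - n) = π t := fun n t => by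
    simp [π]
  have hshift : ∀ (n : ℤ) (x y : ℝ), ∫ t in (x - n)..(y - n), f (π t) = ∫ t in x..y, f (π t) := by
    intro n x y
    rw [← intervalIntegral.integral_comp_sub_right (fun t => f (π t)) (n : ℝ)]
    simp only [hper]
  have harc : ∀ x y, 0 ≤ x → x ≤ 1 → x ≤ y → y ≤ x + 1 →
      ∫ t in x..y, f (π t) ≤ 2 * h (y - x) := by
    intro x y hx hx1 hxy hyx
    rcases le_total y 1 with hy | hy
    · rw [hfg x y hx hxy hy]
      linarith [hgh x y hx hxy hy, hh.nonneg (sub_nonneg.2 hxy) (by linarith)]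
    · rw [← intervalIntegral.integral_add_adjacent_intervals (hfi x 1) (hfi 1 y),
        hfg x 1 hx hx1 le_rfl, ← hshift 1 1 y, Int.cast_one, sub_self,
        hfg 0 (y - 1) le_rfl (by linarith) (by linarith)]
      have h1 := hgh x 1 hx hx1 le_rfl
      have h2 := hgh 0 (y - 1) le_rfl (by linarith) (by linarith)
      have h3 := hh.mono (s := 1 - x) (t := y - x) (by linarith) (by linarith) (by linarith)
      have h4 := hh.mono (s := y - 1 - 0) (t := y - x) (by linarith) (by linarith) (by linarith)
      linarith
  refine ⟨f, hf, ⟨B, fun x => hB _⟩, ?_, ?_, ?_, ?_⟩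
  -- An integer translation brings the left endpoint into [0, 1).
  · rintro _ ⟨a, b, J, hab, hb, h1, h2, rfl⟩
    rw [setIntegral_arc hab hb h1 h2, volume_real_arc hab hb h1 h2, ← hshift ⌊a⌋]
    have := harc (a - ⌊a⌋) (b - ⌊a⌋) (by linarith [Int.floor_le a])
      (by linarith [Int.lt_floor_add_one a]) (by linarith) (by linarith)
    rwa [sub_sub_sub_cancel_right] at this
  · rw [← UnitAddCircle.intervalIntegral_preimage 0, zero_add]
    exact (hfg 0 1 le_rfl zero_le_one le_rfl).trans hg1
  · exact fun x hx => hgR _ (by rwa [mem_preimage, hπr])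
  · exact fun x hxR hxP => hg0 _ (by rwa [mem_preimage, hπr]) (by rwa [mem_preimage, hπr])

/-! ### Core-residual decomposition and conclusion -/

theorem mainTheorem9 (h : ℝ → ℝ) (hh : IsMeasureFunction h)
    (E : Set UnitAddCircle) (hE : NullMeasurableSet E volume)
    (core res : Set UnitAddCircle) (hcr : IsCoreResidual h E core res) :
    ∃ f : ℕ → UnitAddCircle → ℝ,
      (∀ n, Measurable (f n) ∧ ∃ B : ℝ, ∀ x, |f n x| ≤ B) ∧
      (∀ n, ∀ Δ : Set UnitAddCircle, IsArc Δ → ∫ x in Δ, f n x ≤ 2 * h (volume.real Δ)) ∧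
      (∀ n, ∫ x, f n x = 0) ∧
      (∀ n, ∀ᵐ x, x ∈ core → f n x = 0) ∧
      (∀ n, ∀ᵐ x, x ∈ res → f n x ≤ 0) ∧
      (∃ Z : Set UnitAddCircle, volume Z = 0 ∧
        ∀ M : ℝ, ∃ n₀ : ℕ, ∀ n ≥ n₀, ∀ x ∈ res \ Z, f n x ≤ M) := by
  -- Measurable hulls replace core and res, with R = `D \ C` and P = `(C ∪ D)ᶜ`. As core lies in
  -- `C`, the functions vanish at every point of core.
  obtain ⟨C, hcoreC, hC, hCae⟩ := hcr.measurable_core.exists_measurable_superset_ae_eq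
  obtain ⟨D, hresD, hD, hDae⟩ := hcr.measurable_res.exists_measurable_superset_ae_eq
  obtain ⟨N, hN, hEN⟩ := hcr.decomp
  have hresnull : volume (res \ (D \ C)) = 0 := by
    refine measure_mono_null ?_ (ae_eq_set.1 hCae).1
    exact fun x hx => ⟨by_contra fun hxC => hx.2 ⟨hresD hx.1, hxC⟩,
      fun hxc => Set.disjoint_left.1 hcr.disjoint hx.1 hxc⟩
  -- Almost missing P means being almost contained in E, so the decomposition puts `A` almost inside
  -- core, away from R.
  have H : ∀ A, IsHCarleson h A → volume (A ∩ (C ∪ D)ᶜ) = 0 → volume (A ∩ (D \ C)) = 0 := by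
    intro A hA hAP
    have hAE : AlmostContained A E := by
      refine measure_mono_null (t := A ∩ (C ∪ D)ᶜ ∪ (C \ core ∪ (D \ res) ∪ N)) ?_
        (measure_union_null hAP (measure_union_null
          (measure_union_null (ae_eq_set.1 hCae).1 (ae_eq_set.1 hDae).1) hN))
      rintro x ⟨hxA, hxE⟩
      rw [hEN] at hxE
      simp only [Set.mem_sdiff, mem_union, mem_inter_iff, mem_compl_iff] at hxE ⊢
      tauto
    refine measure_mono_null ?_ (hcr.carleson_subset A hA hAE)
    exact fun x hx => ⟨hx.1, fun hxc => hx.2.2 (hcoreC hxc)⟩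
  have hdisj : Disjoint (D \ C) (C ∪ D)ᶜ :=
    Set.disjoint_left.2 fun x hx hx' => hx' (Or.inr hx.1)
  choose f hf hfB hfΔ hf0 hfR hfC using fun n : ℕ =>
    exists_function_circle hh (hD.diff hC) (hC.union hD).compl hdisj H (Nat.cast_nonneg (α := ℝ) n)
  refine ⟨f, fun n => ⟨hf n, hfB n⟩, hfΔ, hf0, fun n => ae_of_all _ fun x hx => ?_, fun n => ?_,
    res \ (D \ C), hresnull, fun M => ?_⟩
  · exact hfC n x (fun h => h.2 (hcoreC hx)) fun h => h (Or.inl (hcoreC hx))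
  · have : ∀ᵐ x, x ∉ res \ (D \ C) := measure_eq_zero_iff_ae_notMem.1 hresnull
    filter_upwards [this] with x hx hxr
    rw [hfR n x (by_contra fun h => hx ⟨hxr, h⟩)]
    simp
  · obtain ⟨n₀, hn₀⟩ := exists_nat_ge (-M)
    refine ⟨n₀, fun n hn x hx => ?_⟩
    rw [hfR n x (by_contra fun h => hx.2 ⟨hx.1, h⟩)]
    have : (n₀ : ℝ) ≤ n := by exact_mod_cast hn
    linarith
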